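/- For each $n\ge 1$ let $v^{(n)}_1,\dots,v^{(n)}_n$ be distinct labelled points on the real line, forming the set $V=V_n$, and let $G$ be a random graph on $\{1,\dots,n\}$ distributed as the binomial random graph $\mathcal G(n,p)$, with $p=p(n)\in[0,1]$; the distance $|v_i-v_j|$ is known exactly when $ij$ is an edge of $G$. A set $U$ of the points is called reconstructible if the known distances determine all pairwise distances within $U$ (equivalently, determine the points of $U$ up to isometry): whenever $w_1,\dots,w_n$ are distinct reals with $|w_i-w_j|=|v_i-v_j|$ for every edge $ij$ of $G$, then $|w_i-w_j|=|v_i-v_j|$ for all $v_i,v_j\in U$. "Whp" means with probability tending to $1$ as $n\to\infty$; inequalities on $p$ are required for all sufficiently large $n$, and $\log$ is the natural logarithm. Then the following hold. (a) There is an absolute constant $c>0$ such that, for every choice of the point sets $V_n$, if $p\ge 42/n$, then whp there is a reconstructible set of size at least $cn$. (b) If $pn\to\infty$, then there is a sequence $\varepsilon_n\to 0$, depending only on the function $p$, such that for every choice of the point sets $V_n$, whp there is a reconstructible set of size at least $(1-\varepsilon_n)n$. (c) For every choice of the point sets $V_n$, if $p\le(\log n+\log\log n-\omega_n)/n$ for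 some sequence $\omega_n\to\infty$, then whp $V_n$ is not reconstructible. (d) For every choice of the point sets $V_n$, if $p\ge(\log n+\log\log n+\omega_n)/n$ for some sequence $\omega_n\to\infty$, then whp $V_n$ is reconstructible. -/

import Mathlib

open Filter Topology unitInterval

/-- The points are `v i`, `i : Fin n`, and `G` is the graph of known distances. The set `U` of
labels is reconstructible if the known distances determine all distances inside `U`: every
placement `w` of the `n` labelled points at distinct positions of the line that agrees with `v` on
the known distances agrees with `v` on all distances between points of `U`. -/
def Reconstructible {n : ℕ} (v : Fin n → ℝ) (G : SimpleGraph (Fin n))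
    (U : Finset (Fin n)) : Prop :=
  ∀ w : Fin n → ℝ, Function.Injective w →
    (∀ i j, G.Adj i j → |w i - w j| = |v i - v j|) →
    ∀ i ∈ U, ∀ j ∈ U, |w i - w j| = |v i - v j|

/-- With high probability: the binomial random graph on `n` labelled vertices with edge
probability `p n` satisfies `E n` with probability tending to `1` as `n → ∞`. -/
def Whp (p : ℕ → I) (E : (n : ℕ) → SimpleGraph (Fin n) → Prop) : Prop :=
  Tendsto (fun n : ℕ => SimpleGraph.binomialRandom (Fin n) (p n) {G | E n G}) atTop (𝓝 1)

/-!
If a placement `w` preserves the distance along an edge, then `w - v` or `w + v` takes the same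
value at its two ends. Hence the level sets of `w - v` and of `w + v` are nearly closed, in the
sense that a vertex outside has at most one neighbour inside: along an edge leaving a level set of
one of the two functions the other one is preserved, so two neighbours inside would share both
values. If any two large disjoint sets are joined by an edge, then some level set has at least
`n / 10` vertices, and so it contains the least nearly closed set `U` of at least `n / 10` vertices.
As `U` does not depend on `w`, it is reconstructible. By a first moment bound there are no nearly
closed sets with between `n / 10` and `n - 2 / p` vertices, and above the threshold none with
between `n - 2 / p` and `n - 1` vertices.

Below the threshold, the second moment method yields a vertex that is isolated, or whose only
neighbour `x` is such that the reflection in `x` moves it to an unoccupied point. Moving this vertex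
preserves the known distances. There are enough such `x` because fewer than `k` points lie on one
side of the `k`-th smallest point, so few pairs of points are symmetric about it.
-/

open Finset MeasureTheory ProbabilityTheory
open scoped SimpleGraph

lemma abs_sub_eq_abs_sub_iff (a b c d : ℝ) :
    |a - b| = |c - d| ↔ a - c = b - d ∨ a + c = b + d := by
  rw [abs_eq_abs]
  constructor <;> rintro (h | h)
  · left; linarith
  · right; linarith
  · left; linarith
  · right; linarith

/-- A vertex set is nearly closed if every vertex outside it has at most one neighbour in it. -/
def NearlyClosed {V : Type*} (G : SimpleGraph V) (R : Finset V) : Prop :=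
  ∀ u ∉ R, ∀ x ∈ R, ∀ y ∈ R, G.Adj u x → G.Adj u y → x = y

section Deterministic

variable {V : Type*} {G : SimpleGraph V}

lemma NearlyClosed.inter [DecidableEq V] {R S : Finset V}
    (hR : NearlyClosed G R) (hS : NearlyClosed G S) : NearlyClosed G (R ∩ S) := by
  intro u hu x hx y hy hux huy
  rw [mem_inter] at hx hy
  by_cases huR : u ∈ R
  · exact hS u (fun huS => hu (mem_inter.2 ⟨huR, huS⟩)) x hx.2 y hy.2 hux huy
  · exact hR u huR x hx.1 y hy.1 hux huy

variable [Fintype V]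

lemma exists_least_nearlyClosed {a M : ℝ} (ha : a ≤ Fintype.card V)
    (haM : Fintype.card V + a ≤ 2 * M) (hM : ∀ R, NearlyClosed G R → a ≤ #R → M < #R) :
    ∃ U, NearlyClosed G U ∧ a ≤ #U ∧ ∀ R, NearlyClosed G R → a ≤ #R → U ⊆ R := by
  classical
  obtain ⟨U, ⟨hU, haU⟩, hmin⟩ : ∃ U, Minimal (fun R => NearlyClosed G R ∧ a ≤ #R) U :=
    Set.Finite.exists_minimal (Set.toFinite _)
      ⟨univ, fun u hu => absurd (mem_univ u) hu, by rwa [card_univ]⟩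
  refine ⟨U, hU, haU, fun R hR haR => ?_⟩
  have hcard : (#U : ℝ) + #R ≤ #(U ∩ R) + Fintype.card V := by
    have := card_union_add_card_inter U R
    have := card_le_univ (U ∪ R)
    exact_mod_cast (by omega : #U + #R ≤ #(U ∩ R) + Fintype.card V)
  have hUR : a ≤ #(U ∩ R) := by linarith [hM U hU haU, hM R hR haR]
  exact (hmin ⟨hU.inter hR, hUR⟩ inter_subset_left).trans inter_subset_right

lemma nearlyClosed_filter_sub_eq {v w : V → ℝ} (hv : Function.Injective v)
    (hw : ∀ i j, G.Adj i j → |w i - w j| = |v i - v j|) (t : ℝ) :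
    NearlyClosed G {i | w i - v i = t} := by
  have add_eq : ∀ u x, w u - v u ≠ t → w x - v x = t → G.Adj u x → w u + v u = w x + v x :=
    fun u x hu hx hux => ((abs_sub_eq_abs_sub_iff _ _ _ _).1 (hw u x hux)).resolve_left
      fun h => hu (h.trans hx)
  intro u hu x hx y hy hux huy
  simp only [mem_filter_univ] at hu hx hy
  have hxu := add_eq u x hu hx hux
  have hyu := add_eq u y hu hy huy
  exact hv (by linarith)

lemma nearlyClosed_filter_add_eq {v w : V → ℝ} (hv : Function.Injective v)
    (hw : ∀ i j, G.Adj i j → |w i - w j| = |v i - v j|) (t : ℝ) :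
    NearlyClosed G {i | w i + v i = t} := by
  have hneg : ∀ i j, G.Adj i j → |(-w) i - (-w) j| = |v i - v j| := fun i j hij => by
    rw [← hw i j hij, Pi.neg_apply, Pi.neg_apply, neg_sub_neg, abs_sub_comm]
  simpa only [Pi.neg_apply, ← neg_add', neg_inj] using nearlyClosed_filter_sub_eq hv hneg (-t)

lemma exists_finset_card_filter_mem {ι α : Type*} [DecidableEq α] (X : Finset ι) (f : ι → α)
    {m k : ℝ} (hm : 0 < m) (hmX : m ≤ #X) (hk : ∀ t, (#{i ∈ X | f i = t} : ℝ) < k) :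
    ∃ s : Finset α, m ≤ #{i ∈ X | f i ∈ s} ∧ (#{i ∈ X | f i ∈ s} : ℝ) < m + k := by
  classical
  obtain ⟨s, hs, hmin⟩ := exists_minimal_of_wellFoundedLT
    (fun s : Finset α => m ≤ #{i ∈ X | f i ∈ s}) ⟨X.image f, by
      rwa [filter_true_of_mem fun i hi => mem_image_of_mem f hi]⟩
  refine ⟨s, hs, ?_⟩
  obtain ⟨t, ht⟩ : s.Nonempty := by
    rw [nonempty_iff_ne_empty]
    rintro rfl
    simp only [notMem_empty, filter_false, card_empty, Nat.cast_zero] at hs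
    exact hs.not_gt hm
  have herase : (#{i ∈ X | f i ∈ s.erase t} : ℝ) < m := by
    by_contra! h
    exact notMem_erase t s (hmin h (erase_subset t s) ht)
  have hsplit : {i ∈ X | f i ∈ s} ⊆ {i ∈ X | f i ∈ s.erase t} ∪ {i ∈ X | f i = t} := fun i => by
    simp only [mem_filter, mem_union, mem_erase]
    tauto
  have hcard : (#{i ∈ X | f i ∈ s} : ℝ) ≤ #{i ∈ X | f i ∈ s.erase t} + #{i ∈ X | f i = t} :=
    mod_cast (card_le_card hsplit).trans (card_union_le _ _)
  linarith [hk t]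

lemma exists_separated_of_small_fibers [Nonempty V] {α β : Type*} [DecidableEq α] [DecidableEq β]
    (a : V → α) (b : V → β)
    (ha : ∀ t, (#{i | a i = t} : ℝ) < Fintype.card V / 10)
    (hb : ∀ t, (#{i | b i = t} : ℝ) < Fintype.card V / 10) :
    ∃ S T : Finset V, Disjoint S T ∧ 3 / 100 * (Fintype.card V : ℝ) ^ 2 ≤ #S * #T ∧
      ∀ i ∈ S, ∀ j ∈ T, a i ≠ a j ∧ b i ≠ b j := by
  classical
  have hn : (0 : ℝ) < Fintype.card V := mod_cast Fintype.card_pos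
  set n : ℝ := (Fintype.card V : ℝ)
  obtain ⟨s, hs, hs'⟩ := exists_finset_card_filter_mem univ a (m := 9 / 20 * n) (k := n / 10)
    (by positivity) (by rw [card_univ]; linarith) ha
  set X : Finset V := {i | a i ∈ s} with hX
  obtain ⟨t, ht, ht'⟩ := exists_finset_card_filter_mem X b (m := #X / 2) (k := n / 10)
    (by linarith) (by linarith) (fun r => (hb r).trans_le' (by gcongr; exact subset_univ X))
  have hXc : (#X : ℝ) + #Xᶜ = n := by rw [← Nat.cast_add, card_add_card_compl]
  have hXt : (#{i ∈ X | b i ∈ t} : ℝ) + #{i ∈ X | b i ∉ t} = #X :=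
    mod_cast card_filter_add_card_filter_not (s := X) fun i => b i ∈ t
  have hXct : (#{i ∈ Xᶜ | b i ∈ t} : ℝ) + #{i ∈ Xᶜ | b i ∉ t} = #Xᶜ :=
    mod_cast card_filter_add_card_filter_not (s := Xᶜ) fun i => b i ∈ t
  have hdisj (P Q : V → Prop) [DecidablePred P] [DecidablePred Q] :
      Disjoint {i ∈ X | P i} {i ∈ Xᶜ | Q i} :=
    disjoint_compl_right.mono (filter_subset _ _) (filter_subset _ _)
  have hne : ∀ i ∈ X, ∀ j ∈ Xᶜ, a i ≠ a j := fun i hi j hj hij => by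
    rw [mem_compl, hX, mem_filter_univ, ← hij] at hj
    exact hj ((mem_filter_univ i).1 hi)
  rcases le_total (#Xᶜ / 2 : ℝ) #{i ∈ Xᶜ | b i ∉ t} with h | h
  · refine ⟨{i ∈ X | b i ∈ t}, {i ∈ Xᶜ | b i ∉ t}, hdisj _ _, ?_, fun i hi j hj => ?_⟩
    · have := mul_le_mul ht h (by positivity) (by positivity)
      nlinarith
    · rw [mem_filter] at hi hj
      exact ⟨hne i hi.1 j hj.1, fun hij => hj.2 (hij ▸ hi.2)⟩
  · refine ⟨{i ∈ X | b i ∉ t}, {i ∈ Xᶜ | b i ∈ t}, hdisj _ _, ?_, fun i hi j hj => ?_⟩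
    · have := mul_le_mul (by linarith : (#X / 2 - n / 10 : ℝ) ≤ #{i ∈ X | b i ∉ t})
        (by linarith : (#Xᶜ / 2 : ℝ) ≤ #{i ∈ Xᶜ | b i ∈ t}) (by positivity) (by positivity)
      nlinarith
    · rw [mem_filter] at hi hj
      exact ⟨hne i hi.1 j hj.1, fun hij => hi.2 (hij ▸ hj.2)⟩

lemma exists_large_fiber [Nonempty V] {v w : V → ℝ}
    (hw : ∀ i j, G.Adj i j → |w i - w j| = |v i - v j|)
    (hedge : ∀ S T : Finset V, Disjoint S T → 3 / 100 * (Fintype.card V : ℝ) ^ 2 ≤ #S * #T →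
      ∃ i ∈ S, ∃ j ∈ T, G.Adj i j) :
    (∃ t, (Fintype.card V / 10 : ℝ) ≤ #{i | w i - v i = t}) ∨
      ∃ t, (Fintype.card V / 10 : ℝ) ≤ #{i | w i + v i = t} := by
  by_contra! ⟨hsub, hadd⟩
  obtain ⟨S, T, hST, hcard, hsep⟩ := exists_separated_of_small_fibers _ _ hsub hadd
  obtain ⟨i, hi, j, hj, hij⟩ := hedge S T hST hcard
  rcases (abs_sub_eq_abs_sub_iff _ _ _ _).1 (hw i j hij) with h | h
  · exact (hsep i hi j hj).1 h
  · exact (hsep i hi j hj).2 h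

lemma exists_reconstructible {n : ℕ} [NeZero n] {v : Fin n → ℝ} (hv : Function.Injective v)
    {G : SimpleGraph (Fin n)} {M : ℝ} (hM : 11 / 20 * (n : ℝ) ≤ M)
    (hedge : ∀ S T : Finset (Fin n), Disjoint S T → 3 / 100 * (n : ℝ) ^ 2 ≤ #S * #T →
      ∃ i ∈ S, ∃ j ∈ T, G.Adj i j)
    (hclosed : ∀ R, NearlyClosed G R → (n : ℝ) / 10 ≤ #R → M < #R) :
    ∃ U, Reconstructible v G U ∧ NearlyClosed G U ∧ M < #U := by
  have : (0 : ℝ) ≤ n := n.cast_nonneg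
  obtain ⟨U, hU, hnU, hleast⟩ := exists_least_nearlyClosed (G := G) (a := n / 10) (M := M)
    (by rw [Fintype.card_fin]; linarith) (by rw [Fintype.card_fin]; linarith) hclosed
  refine ⟨U, fun w _ hw i hi j hj => ?_, hU, hclosed U hU hnU⟩
  rw [abs_sub_eq_abs_sub_iff]
  rcases exists_large_fiber hw (by rwa [Fintype.card_fin]) with ⟨t, ht⟩ | ⟨t, ht⟩
  all_goals rw [Fintype.card_fin] at ht
  · have hUt := hleast _ (nearlyClosed_filter_sub_eq hv hw t) ht
    exact .inl (((mem_filter_univ i).1 (hUt hi)).trans ((mem_filter_univ j).1 (hUt hj)).symm)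
  · have hUt := hleast _ (nearlyClosed_filter_add_eq hv hw t) ht
    exact .inr (((mem_filter_univ i).1 (hUt hi)).trans ((mem_filter_univ j).1 (hUt hj)).symm)

end Deterministic

section RandomGraph

lemma setBernoulli_real_forall_mem_iff {α ι : Type*} [Countable α] [Fintype ι] (p : I) {u : Set α}
    {f : ι → α} (hf : Function.Injective f) (hfu : ∀ i, f i ∈ u) (b : ι → Prop)
    [DecidablePred b] :
    setBer(u, p).real {s | ∀ i, f i ∈ s ↔ b i} = ∏ i, if b i then (p : ℝ) else 1 - p := by
  have hbox : (fun q : α → Prop => {e | q e}) ⁻¹' {s : Set α | ∀ i, f i ∈ s ↔ b i} =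
      Set.pi (univ.map ⟨f, hf⟩ : Finset α) fun e => {x : Prop | ∀ i, f i = e → (x ↔ b i)} := by
    ext q
    simp only [Set.mem_preimage, Set.mem_ofPred_eq, Set.mem_pi, coe_map, coe_univ,
      Set.image_univ, Set.mem_range, Function.Embedding.coeFn_mk, forall_exists_index,
      forall_apply_eq_imp_iff, hf.eq_iff, forall_eq]
  rw [measureReal_def, setBernoulli_apply', hbox,
    Measure.infinitePi_pi _ (fun _ _ => MeasurableSet.of_discrete), prod_map,
    ENNReal.toReal_prod]
  refine prod_congr rfl fun i _ => ?_
  simp only [Function.Embedding.coeFn_mk, hf.eq_iff, forall_eq]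
  by_cases hb : b i <;> simp [hb, hfu]

variable {V : Type*}

instance discreteMeasurableSpace_simpleGraph [Finite V] :
    DiscreteMeasurableSpace (SimpleGraph V) :=
  have : MeasurableSingletonClass (SimpleGraph V) :=
    ⟨fun G => SimpleGraph.measurableEmbedding_edgeSet.measurableSet_image.1 <| by
      rw [Set.image_singleton]
      exact .of_discrete⟩
  inferInstance

lemma binomialRandom_real_forall_mem_edgeSet_iff {ι : Type*} [Finite V] [Fintype ι] (p : I)
    {f : ι → Sym2 V} (hf : Function.Injective f) (hd : ∀ i, ¬ (f i).IsDiag)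
    (b : ι → Prop) [DecidablePred b] :
    G(V, p).real {G | ∀ i, f i ∈ G.edgeSet ↔ b i} = ∏ i, if b i then (p : ℝ) else 1 - p := by
  have hdiag (i : ι) : f i ∈ (Sym2.diagSetᶜ : Set (Sym2 V)) := hd i
  rw [SimpleGraph.binomialRandom_eq_map,
    map_measureReal_apply SimpleGraph.measurable_fromEdgeSet .of_discrete,
    ← setBernoulli_real_forall_mem_iff p hf hdiag]
  simp only [Set.preimage_ofPred_eq, SimpleGraph.edgeSet_fromEdgeSet, Set.mem_sdiff,
    Sym2.mem_diagSet, hd, not_false_eq_true, and_true]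

/-- Among the vertices of `D`, the vertex `u` is adjacent exactly to the one selected by `o`, and
to none if `o = none`. -/
def HasStar (G : SimpleGraph V) (D : Finset V) (u : V) (o : Option V) : Prop :=
  ∀ y ∈ D, G.Adj u y ↔ o = some y

open scoped Classical in
/-- The probability that a vertex outside `D` has the star `o` into `D`. -/
noncomputable def starWeight (p : ℝ) (D : Finset V) (o : Option V) : ℝ :=
  ∏ y ∈ D, if o = some y then p else 1 - p

lemma starWeight_none (p : ℝ) (D : Finset V) : starWeight p D none = (1 - p) ^ #D := by
  simp [starWeight]

lemma starWeight_some_of_mem (p : ℝ) {D : Finset V} {x : V} (hx : x ∈ D) :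
    starWeight p D (some x) = p * (1 - p) ^ (#D - 1) := by
  classical
  rw [starWeight, ← mul_prod_erase D _ hx, if_pos rfl, ← card_erase_of_mem hx,
    prod_congr rfl fun y hy => if_neg ?_, prod_const]
  rw [Option.some_inj]
  exact (ne_of_mem_erase hy).symm

lemma sum_insertNone_starWeight (p : ℝ) {D T : Finset V} (hT : T ⊆ D) :
    ∑ o ∈ insertNone T, starWeight p D o =
      (1 - p) ^ #D + #T * (p * (1 - p) ^ (#D - 1)) := by
  rw [sum_insertNone, starWeight_none, sum_congr rfl fun x hx => starWeight_some_of_mem p (hT hx),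
    sum_const, nsmul_eq_mul]

lemma binomialRandom_real_forall_hasStar {ι : Type*} [Finite V] [Fintype ι] (p : I) {u : ι → V}
    (hu : Function.Injective u) {D : ι → Finset V} (hD : ∀ i j, u i ∈ D j → u j ∉ D i)
    (o : ι → Option V) :
    G(V, p).real {G | ∀ i, HasStar G (D i) (u i) (o i)} = ∏ i, starWeight p (D i) (o i) := by
  classical
  have hinj : Function.Injective fun a : Σ i, D i => s(u a.1, (a.2 : V)) := by
    rintro ⟨i, x, hx⟩ ⟨j, y, hy⟩ h
    rcases Sym2.eq_iff.1 h with ⟨hij, rfl : x = y⟩ | ⟨rfl : u i = y, rfl : x = u j⟩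
    · obtain rfl := hu hij
      rfl
    · exact absurd hx (hD i j hy)
  have hdiag (a : Σ i, D i) : ¬ s(u a.1, (a.2 : V)).IsDiag := by
    rintro (h : u a.1 = a.2)
    exact hD a.1 a.1 (h ▸ a.2.2) (h ▸ a.2.2)
  have hset : {G : SimpleGraph V | ∀ i, HasStar G (D i) (u i) (o i)} =
      {G | ∀ a : Σ i, D i, s(u a.1, (a.2 : V)) ∈ G.edgeSet ↔ o a.1 = some (a.2 : V)} := by
    simp only [HasStar, Sigma.forall, Subtype.forall, SimpleGraph.mem_edgeSet]
  rw [hset, binomialRandom_real_forall_mem_edgeSet_iff p hinj hdiag, Fintype.prod_sigma]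
  exact prod_congr rfl fun i _ =>
    prod_coe_sort (D i) fun y => if o i = some y then (p : ℝ) else 1 - p

lemma binomialRandom_real_hasStar [Finite V] (p : I) {D : Finset V} {u : V} (hu : u ∉ D)
    (o : Option V) : G(V, p).real {G | HasStar G D u o} = starWeight p D o := by
  simpa using binomialRandom_real_forall_hasStar p (ι := Unit) (u := fun _ => u)
    (Function.injective_of_subsingleton _) (D := fun _ => D) (fun _ _ h => absurd h hu) fun _ => o

lemma binomialRandom_real_hasStar_and_hasStar [Finite V] (p : I) {D D' : Finset V} {u u' : V}
    (huu' : u ≠ u') (hu : u ∉ D) (hu' : u' ∉ D') (hD : u ∈ D' → u' ∉ D) (o o' : Option V) :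
    G(V, p).real {G | HasStar G D u o ∧ HasStar G D' u' o'} =
      starWeight p D o * starWeight p D' o' := by
  have h := binomialRandom_real_forall_hasStar p (ι := Bool) (u := fun b => cond b u u')
    (D := fun b => cond b D D') (o := fun b => cond b o o')
    (by simpa [Function.Injective, huu'] using huu'.symm)
    (by simpa [hu, hu'] using ⟨fun h h' => hD h' h, hD⟩)
  simpa [and_comm] using h

end RandomGraph

section UnionBounds

lemma measureReal_exists_mem_le {Ω ι : Type*} [MeasurableSpace Ω] (μ : Measure Ω)
    [IsFiniteMeasure μ] (F : Finset ι) (E : ι → Ω → Prop) :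
    μ.real {x | ∃ i ∈ F, E i x} ≤ ∑ i ∈ F, μ.real {x | E i x} := by
  have hset : {x | ∃ i ∈ F, E i x} = ⋃ i ∈ F, {x | E i x} := by
    ext x
    simp
  exact hset ▸ measureReal_biUnion_finset_le F fun i => {x | E i x}

lemma one_sub_pow_le_exp {p : ℝ} (hp : p ≤ 1) (k : ℕ) : (1 - p) ^ k ≤ Real.exp (-(k * p)) := by
  rw [← mul_neg, Real.exp_nat_mul]
  exact pow_le_pow_left₀ (sub_nonneg.2 hp) (Real.one_sub_le_exp_neg p) k

variable {V : Type*}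

lemma binomialRandom_real_forall_not_adj_le [Finite V] (p : I) {S T : Finset V}
    (hST : Disjoint S T) :
    G(V, p).real {G | ∀ i ∈ S, ∀ j ∈ T, ¬ G.Adj i j} ≤ Real.exp (-(#S * #T * p)) := by
  have hset : {G : SimpleGraph V | ∀ i ∈ S, ∀ j ∈ T, ¬ G.Adj i j} =
      {G | ∀ i : S, HasStar G T i none} := by
    simp [HasStar]
  rw [hset, binomialRandom_real_forall_hasStar p Subtype.val_injective
    (fun i _ hi => absurd hi (disjoint_left.1 hST i.2)) fun _ => none]
  simp only [starWeight_none, prod_const, card_univ, Fintype.card_coe, ← pow_mul]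
  simpa [mul_comm (#S : ℝ)] using one_sub_pow_le_exp p.2.2 (#T * #S)

/-- The probability that a Poisson variable of mean `y` is at most `1`. -/
noncomputable def poissonAtMostOne (y : ℝ) : ℝ := Real.exp (-y) * (1 + y)

lemma poissonAtMostOne_nonneg {y : ℝ} (hy : 0 ≤ y) : 0 ≤ poissonAtMostOne y := by
  unfold poissonAtMostOne
  positivity

lemma antitoneOn_poissonAtMostOne : AntitoneOn poissonAtMostOne (Set.Ici 0) := by
  intro x (hx : 0 ≤ x) y _ hxy
  have hexp : 1 + y ≤ Real.exp (y - x) * (1 + x) := by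
    nlinarith [Real.add_one_le_exp (y - x)]
  calc Real.exp (-y) * (1 + y) ≤ Real.exp (-y) * (Real.exp (y - x) * (1 + x)) := by gcongr
    _ = poissonAtMostOne x := by
        rw [poissonAtMostOne, ← mul_assoc, ← Real.exp_add]
        ring_nf

lemma poissonAtMostOne_le_exp_neg_half {y : ℝ} (hy : 3 ≤ y) :
    poissonAtMostOne y ≤ Real.exp (-(y / 2)) := by
  have hexp : 1 + y ≤ Real.exp (y / 2) :=
    calc 1 + y ≤ (1 + y / 4 + (y / 4) ^ 2 / 2) ^ 2 := by
          nlinarith [mul_nonneg (sq_nonneg y) (sub_nonneg.2 hy)]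
      _ ≤ Real.exp (y / 4) ^ 2 := by
          gcongr
          exact Real.quadratic_le_exp_of_nonneg (by linarith)
      _ = Real.exp (y / 2) := by
          rw [← Real.exp_nat_mul]
          ring_nf
  calc poissonAtMostOne y ≤ Real.exp (-y) * Real.exp (y / 2) := by
        unfold poissonAtMostOne
        gcongr
    _ = Real.exp (-(y / 2)) := by
        rw [← Real.exp_add]
        ring_nf

lemma sum_insertNone_starWeight_le {p : ℝ} (hp0 : 0 ≤ p) (hp1 : p ≤ 1) {R : Finset V}
    (hR : R.Nonempty) :
    ∑ o ∈ insertNone R, starWeight p R o ≤ poissonAtMostOne ((#R - 1) * p) := by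
  obtain ⟨k, hk⟩ := Nat.exists_eq_add_of_le' hR.card_pos
  have hexp := one_sub_pow_le_exp hp1 k
  rw [sum_insertNone_starWeight p subset_rfl, poissonAtMostOne, hk]
  calc (1 - p) ^ (k + 1) + (k + 1 : ℕ) * (p * (1 - p) ^ (k + 1 - 1))
      = (1 - p) ^ k * (1 + k * p) := by
        rw [Nat.add_sub_cancel]
        push_cast
        ring
    _ ≤ Real.exp (-(k * p)) * (1 + k * p) := by gcongr
    _ = _ := by push_cast; ring_nf

lemma exists_hasStar {G : SimpleGraph V} {D : Finset V} {u : V}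
    (h : ∀ x ∈ D, ∀ y ∈ D, G.Adj u x → G.Adj u y → x = y) :
    ∃ o ∈ insertNone D, HasStar G D u o := by
  by_cases hx : ∃ x ∈ D, G.Adj u x
  · obtain ⟨x, hxD, hux⟩ := hx
    refine ⟨some x, some_mem_insertNone.2 hxD, fun y hy => ?_⟩
    rw [Option.some_inj]
    exact ⟨h x hxD y hy hux, fun hxy => hxy ▸ hux⟩
  · push Not at hx
    exact ⟨none, none_mem_insertNone, fun y hy => by simp [hx y hy]⟩

variable [Fintype V]

lemma card_sigma_powerset_compl [DecidableEq V] :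
    #((univ : Finset (Finset V)).sigma fun S => Sᶜ.powerset) = 3 ^ Fintype.card V := by
  simp_rw [card_sigma, card_powerset, card_compl]
  simpa using Fintype.sum_pow_mul_eq_add_pow V (1 : ℕ) 2

lemma binomialRandom_real_exists_forall_not_adj_le (p : I) (a : ℝ) :
    G(V, p).real {G | ∃ S T : Finset V, Disjoint S T ∧ a ≤ #S * #T ∧
      ∀ i ∈ S, ∀ j ∈ T, ¬ G.Adj i j} ≤ 3 ^ Fintype.card V * Real.exp (-(a * p)) := by
  classical
  let F : Finset (Σ _ : Finset V, Finset V) :=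
    {x ∈ univ.sigma fun S => Sᶜ.powerset | a ≤ #x.1 * #x.2}
  have hF {S T : Finset V} : ⟨S, T⟩ ∈ F ↔ Disjoint S T ∧ a ≤ #S * #T := by
    simp [F, subset_compl_iff_disjoint_left]
  calc _ ≤ G(V, p).real {G | ∃ x ∈ F, ∀ i ∈ x.1, ∀ j ∈ x.2, ¬ G.Adj i j} := by
        refine measureReal_mono ?_
        rintro G ⟨S, T, hST, ha, hG⟩
        exact ⟨⟨S, T⟩, hF.2 ⟨hST, ha⟩, hG⟩
    _ ≤ ∑ _ ∈ F, Real.exp (-(a * p)) := by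
        refine (measureReal_exists_mem_le _ F _).trans (sum_le_sum fun ⟨S, T⟩ hx => ?_)
        obtain ⟨hST, ha⟩ := hF.1 hx
        refine (binomialRandom_real_forall_not_adj_le p hST).trans ?_
        gcongr
        exact p.2.1
    _ ≤ 3 ^ Fintype.card V * Real.exp (-(a * p)) := by
        rw [sum_const, nsmul_eq_mul]
        gcongr
        exact_mod_cast (card_filter_le _ _).trans_eq card_sigma_powerset_compl

lemma binomialRandom_real_nearlyClosed_le (p : I) {R : Finset V} (hR : R.Nonempty) :
    G(V, p).real {G | NearlyClosed G R} ≤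
      poissonAtMostOne ((#R - 1) * p) ^ (Fintype.card V - #R) := by
  classical
  let F : Finset (↥Rᶜ → Option V) := Fintype.piFinset fun _ => insertNone R
  have hD (i j : ↥Rᶜ) : (i : V) ∈ R → (j : V) ∉ R := fun hi => absurd hi (mem_compl.1 i.2)
  have hsub : {G : SimpleGraph V | NearlyClosed G R} ⊆
      {G | ∃ φ ∈ F, ∀ u : ↥Rᶜ, HasStar G R u (φ u)} := by
    intro G hG
    choose φ hφ hstar using fun u : ↥Rᶜ => exists_hasStar (hG u (mem_compl.1 u.2))
    exact ⟨φ, Fintype.mem_piFinset.2 hφ, hstar⟩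
  calc G(V, p).real {G | NearlyClosed G R}
      ≤ ∑ φ ∈ F, G(V, p).real {G | ∀ u : ↥Rᶜ, HasStar G R u (φ u)} :=
        (measureReal_mono hsub).trans (measureReal_exists_mem_le _ F _)
    _ = ∑ φ ∈ F, ∏ u, starWeight p R (φ u) := sum_congr rfl fun φ _ =>
        binomialRandom_real_forall_hasStar p Subtype.val_injective (D := fun _ => R) hD φ
    _ = (∑ o ∈ insertNone R, starWeight p R o) ^ (Fintype.card V - #R) := by
        rw [← prod_univ_sum, prod_const, card_univ, Fintype.card_coe, card_compl]
    _ ≤ _ := by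
        have h0 (o : Option V) : 0 ≤ starWeight p R o :=
          prod_nonneg fun y _ => by split_ifs; exacts [p.2.1, sub_nonneg.2 p.2.2]
        gcongr
        · exact sum_nonneg fun o _ => h0 o
        · exact sum_insertNone_starWeight_le p.2.1 p.2.2 hR

lemma nine_fifths_mul_le {n r p : ℝ} (hn : 1000 ≤ n) (hp : 42 ≤ p * n) (hr : n / 10 ≤ r)
    (hrp : 2 ≤ p * (n - r)) : 9 / 5 * n ≤ (r - 1) * (p * (n - r)) := by
  rcases le_total (19 / 20 * n) r with h | h
  · nlinarith
  · have hrs : 19 / 400 * n ^ 2 ≤ r * (n - r) := by nlinarith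
    have hprs : 42 * (19 / 400 * n) ≤ r * (p * (n - r)) := by nlinarith
    nlinarith

lemma binomialRandom_real_exists_nearlyClosed_le {p : I} (hp : 42 ≤ (p : ℝ) * Fintype.card V)
    (hV : 1000 ≤ Fintype.card V) :
    G(V, p).real {G | ∃ R, NearlyClosed G R ∧ (Fintype.card V : ℝ) / 10 ≤ #R ∧
      (#R : ℝ) ≤ Fintype.card V - 2 / p} ≤ (2 * Real.exp (-(9 / 10))) ^ Fintype.card V := by
  set n := Fintype.card V with hn
  have hn' : (1000 : ℝ) ≤ n := mod_cast hV
  have hp0 : 0 < (p : ℝ) := pos_of_mul_pos_left (by linarith) n.cast_nonneg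
  let F : Finset (Finset V) := {R | (n : ℝ) / 10 ≤ #R ∧ (#R : ℝ) ≤ n - 2 / p}
  have hterm : ∀ R ∈ F, G(V, p).real {G | NearlyClosed G R} ≤ Real.exp (-(9 / 10)) ^ n := by
    intro R hR
    obtain ⟨hnR, hRn⟩ := (mem_filter_univ R).1 hR
    have hR0 : R.Nonempty := by
      rw [← card_pos, ← Nat.cast_pos (α := ℝ)]
      linarith
    have hmean : 3 ≤ (#R - 1) * (p : ℝ) := by nlinarith [p.2.2]
    have hexponent := nine_fifths_mul_le hn' hp hnR
      ((div_le_iff₀' hp0).1 (by linarith : 2 / (p : ℝ) ≤ n - #R))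
    calc G(V, p).real {G | NearlyClosed G R}
        ≤ poissonAtMostOne ((#R - 1) * p) ^ (n - #R) := binomialRandom_real_nearlyClosed_le p hR0
      _ ≤ Real.exp (-((#R - 1) * p / 2)) ^ (n - #R) := by
          gcongr
          · exact poissonAtMostOne_nonneg (by linarith)
          · exact poissonAtMostOne_le_exp_neg_half hmean
      _ ≤ Real.exp (-(9 / 10)) ^ n := by
          rw [← Real.exp_nat_mul, ← Real.exp_nat_mul, Nat.cast_sub (card_le_univ R), ← hn,
            Real.exp_le_exp]
          linarith
  calc _ ≤ G(V, p).real {G | ∃ R ∈ F, NearlyClosed G R} := by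
        refine measureReal_mono ?_
        rintro G ⟨R, hG, hR⟩
        exact ⟨R, (mem_filter_univ R).2 hR, hG⟩
    _ ≤ #F * Real.exp (-(9 / 10)) ^ n := by
        rw [← nsmul_eq_mul]
        exact (measureReal_exists_mem_le _ F _).trans (sum_le_card_nsmul _ _ _ hterm)
    _ ≤ (2 * Real.exp (-(9 / 10))) ^ n := by
        rw [mul_pow]
        gcongr
        exact_mod_cast (card_le_univ F).trans_eq Fintype.card_finset

lemma sum_erase_univ_pow_le [DecidableEq V] {z : ℝ} (hz : 0 ≤ z) :
    ∑ R ∈ (univ : Finset (Finset V)).erase univ, z ^ (Fintype.card V - #R) ≤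
      Real.exp (Fintype.card V * z) - 1 := by
  have hsum : ∑ R : Finset V, z ^ (Fintype.card V - #R) = (1 + z) ^ Fintype.card V := by
    simpa using Fintype.sum_pow_mul_eq_add_pow V 1 z
  have herase := add_sum_erase univ (fun R : Finset V => z ^ (Fintype.card V - #R))
    (mem_univ univ)
  rw [hsum, card_univ, Nat.sub_self, pow_zero] at herase
  rw [le_sub_iff_add_le', herase, Real.exp_nat_mul]
  gcongr
  linarith [Real.add_one_le_exp z]

lemma binomialRandom_real_exists_large_nearlyClosed_le {p : I}
    (hp : 3 ≤ (p : ℝ) * Fintype.card V) :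
    G(V, p).real {G | ∃ R, NearlyClosed G R ∧ R ≠ univ ∧ (Fintype.card V : ℝ) - 2 / p < #R} ≤
      Real.exp (Fintype.card V * poissonAtMostOne (p * Fintype.card V - 3)) - 1 := by
  classical
  set n := Fintype.card V
  have hp0 : 0 < (p : ℝ) := pos_of_mul_pos_left (by linarith) n.cast_nonneg
  let F : Finset (Finset V) := {R ∈ univ.erase univ | (n : ℝ) - 2 / p < #R}
  have hz : 0 ≤ poissonAtMostOne (p * n - 3) := poissonAtMostOne_nonneg (by linarith)
  have hterm : ∀ R ∈ F, G(V, p).real {G | NearlyClosed G R} ≤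
      poissonAtMostOne (p * n - 3) ^ (n - #R) := by
    intro R hR
    have hRp : (n - #R) * (p : ℝ) < 2 := by
      rw [← lt_div_iff₀ hp0]
      linarith [(mem_filter.1 hR).2]
    have hR0 : R.Nonempty := by
      rw [← card_pos, ← Nat.cast_pos (α := ℝ)]
      nlinarith
    have hmean : (p : ℝ) * n - 3 ≤ (#R - 1) * p := by linarith [p.2.2]
    refine (binomialRandom_real_nearlyClosed_le p hR0).trans ?_
    gcongr
    · exact poissonAtMostOne_nonneg (by linarith)
    · exact antitoneOn_poissonAtMostOne (Set.mem_Ici.2 (by linarith))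
        (Set.mem_Ici.2 (by linarith)) hmean
  calc _ ≤ G(V, p).real {G | ∃ R ∈ F, NearlyClosed G R} := by
        refine measureReal_mono ?_
        rintro G ⟨R, hG, hRu, hRn⟩
        exact ⟨R, mem_filter.2 ⟨mem_erase.2 ⟨hRu, mem_univ R⟩, hRn⟩, hG⟩
    _ ≤ ∑ R ∈ F, poissonAtMostOne (p * n - 3) ^ (n - #R) :=
        (measureReal_exists_mem_le _ F _).trans (sum_le_sum hterm)
    _ ≤ ∑ R ∈ univ.erase univ, poissonAtMostOne (p * n - 3) ^ (n - #R) :=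
        sum_le_sum_of_subset_of_nonneg (filter_subset _ _) fun _ _ _ => by positivity
    _ ≤ Real.exp (n * poissonAtMostOne (p * n - 3)) - 1 := sum_erase_univ_pow_le hz

end UnionBounds

section Whp

variable {p : ℕ → I} {E F : (n : ℕ) → SimpleGraph (Fin n) → Prop}

lemma whp_iff_tendsto_real_not : Whp p E ↔
    Tendsto (fun n => G(Fin n, p n).real {G | ¬ E n G}) atTop (𝓝 0) := by
  have hcompl (n : ℕ) : {G | ¬ E n G} = {G | E n G}ᶜ := rfl
  simp_rw [hcompl, probReal_compl_eq_one_sub MeasurableSet.of_discrete, Whp,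
    ← ENNReal.tendsto_toReal_iff (fun _ => measure_ne_top _ _) ENNReal.one_ne_top]
  exact ⟨fun h => by simpa [measureReal_def] using h.const_sub 1,
    fun h => by simpa [measureReal_def] using h.const_sub 1⟩

lemma Whp.of_real_le {b : ℕ → ℝ} (hb : Tendsto b atTop (𝓝 0))
    (h : ∀ᶠ n in atTop, G(Fin n, p n).real {G | ¬ E n G} ≤ b n) : Whp p E :=
  whp_iff_tendsto_real_not.2 <| squeeze_zero' (.of_forall fun _ => measureReal_nonneg) h hb

lemma Whp.mono (hE : Whp p E) (h : ∀ᶠ n in atTop, ∀ G, E n G → F n G) : Whp p F := by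
  refine .of_real_le (whp_iff_tendsto_real_not.1 hE) ?_
  filter_upwards [h] with n hn
  exact measureReal_mono fun G hG hE => hG (hn G hE)

lemma Whp.and (hE : Whp p E) (hF : Whp p F) : Whp p fun n G => E n G ∧ F n G := by
  have hsum := (whp_iff_tendsto_real_not.1 hE).add (whp_iff_tendsto_real_not.1 hF)
  rw [add_zero] at hsum
  refine .of_real_le hsum (.of_forall fun n => ?_)
  refine le_trans (measureReal_mono fun G hG => ?_) (measureReal_union_le _ _)
  exact not_and_or.1 hG

end Whp

section LargeReconstructible

variable {p : ℕ → I}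

lemma whp_exists_adj_of_large (hp : ∀ᶠ n : ℕ in atTop, 42 ≤ (p n : ℝ) * n) :
    Whp p fun n G => ∀ S T : Finset (Fin n), Disjoint S T → 3 / 100 * (n : ℝ) ^ 2 ≤ #S * #T →
      ∃ i ∈ S, ∃ j ∈ T, G.Adj i j := by
  have hbase : 3 * Real.exp (-(63 / 50)) < 1 := by
    rw [Real.exp_neg, ← div_eq_mul_inv, div_lt_one (Real.exp_pos _)]
    linarith [Real.quadratic_le_exp_of_nonneg (x := 63 / 50) (by norm_num)]
  refine .of_real_le (tendsto_pow_atTop_nhds_zero_of_lt_one (by positivity) hbase) ?_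
  filter_upwards [hp] with n hpn
  push Not
  refine (binomialRandom_real_exists_forall_not_adj_le (p n) _).trans ?_
  rw [Fintype.card_fin, mul_pow, ← Real.exp_nat_mul]
  gcongr
  nlinarith [mul_le_mul_of_nonneg_left hpn n.cast_nonneg]

lemma whp_lt_card_of_nearlyClosed (hp : ∀ᶠ n : ℕ in atTop, 42 ≤ (p n : ℝ) * n) :
    Whp p fun n G => ∀ R, NearlyClosed G R → (n : ℝ) / 10 ≤ #R → (n : ℝ) - 2 / p n < #R := by
  have hbase : 2 * Real.exp (-(9 / 10)) < 1 := by
    rw [Real.exp_neg, ← div_eq_mul_inv, div_lt_one (Real.exp_pos _)]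
    linarith [Real.quadratic_le_exp_of_nonneg (x := 9 / 10) (by norm_num)]
  refine .of_real_le (tendsto_pow_atTop_nhds_zero_of_lt_one (by positivity) hbase) ?_
  filter_upwards [hp, eventually_ge_atTop 1000] with n hpn hn
  push Not
  have h := binomialRandom_real_exists_nearlyClosed_le (V := Fin n) (p := p n)
    (by rwa [Fintype.card_fin]) (by rwa [Fintype.card_fin])
  rwa [Fintype.card_fin] at h

lemma two_div_le_mul {n p a : ℝ} (ha : 0 < a) (hn : 0 ≤ n) (hp : a ≤ p * n) :
    2 / p ≤ 2 / a * n := by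
  have hp0 : 0 < p := pos_of_mul_pos_left (by linarith) hn
  rw [div_mul_eq_mul_div, div_le_div_iff₀ hp0 ha]
  linarith

lemma whp_exists_reconstructible (hp : ∀ᶠ n : ℕ in atTop, 42 ≤ (p n : ℝ) * n)
    {v : (n : ℕ) → Fin n → ℝ} (hv : ∀ n, Function.Injective (v n)) :
    Whp p fun n G => ∃ U : Finset (Fin n), Reconstructible (v n) G U ∧ NearlyClosed G U ∧
      (n : ℝ) - 2 / p n < #U := by
  refine ((whp_exists_adj_of_large hp).and (whp_lt_card_of_nearlyClosed hp)).mono ?_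
  filter_upwards [hp, eventually_ne_atTop 0] with n hpn hn G ⟨hedge, hclosed⟩
  have : NeZero n := ⟨hn⟩
  have := two_div_le_mul (by norm_num) n.cast_nonneg hpn
  exact exists_reconstructible (hv n) (by linarith [n.cast_nonneg (α := ℝ)]) hedge hclosed

lemma eventually_le_mul_of_eventually_div_le {f : ℕ → ℝ}
    (hp : ∀ᶠ n : ℕ in atTop, f n / (n : ℝ) ≤ p n) :
    ∀ᶠ n : ℕ in atTop, f n ≤ (p n : ℝ) * n := by
  filter_upwards [hp, eventually_gt_atTop 0] with n hpn hn
  rwa [div_le_iff₀ (Nat.cast_pos.2 hn)] at hpn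

theorem exists_linear_reconstructible :
    ∃ c : ℝ, 0 < c ∧
      ∀ (v : (n : ℕ) → Fin n → ℝ) (p : ℕ → I), (∀ n, Function.Injective (v n)) →
        (∀ᶠ n : ℕ in atTop, 42 / (n : ℝ) ≤ (p n : ℝ)) →
        Whp p fun n G => ∃ U : Finset (Fin n), Reconstructible (v n) G U ∧
          c * (n : ℝ) ≤ (#U : ℝ) := by
  refine ⟨1 / 2, by norm_num, fun v p hv hp => ?_⟩
  have hp' := eventually_le_mul_of_eventually_div_le hp
  refine (whp_exists_reconstructible hp' hv).mono ?_
  filter_upwards [hp'] with n hpn G ⟨U, hU, _, hcard⟩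
  have := two_div_le_mul (by norm_num) n.cast_nonneg hpn
  exact ⟨U, hU, by linarith [n.cast_nonneg (α := ℝ)]⟩

theorem exists_almost_spanning_reconstructible (p : ℕ → I)
    (hp : Tendsto (fun n : ℕ => (p n : ℝ) * (n : ℝ)) atTop atTop) :
    ∃ ε : ℕ → ℝ, Tendsto ε atTop (𝓝 0) ∧
      ∀ v : (n : ℕ) → Fin n → ℝ, (∀ n, Function.Injective (v n)) →
        Whp p fun n G => ∃ U : Finset (Fin n), Reconstructible (v n) G U ∧
          (1 - ε n) * (n : ℝ) ≤ (#U : ℝ) := by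
  refine ⟨fun n => 2 / (p n * n), hp.const_div_atTop 2, fun v hv => ?_⟩
  have hp' := hp.eventually_ge_atTop 42
  refine (whp_exists_reconstructible hp' hv).mono ?_
  filter_upwards [hp'] with n hpn G ⟨U, hU, _, hcard⟩
  have := two_div_le_mul (by linarith) n.cast_nonneg (le_refl ((p n : ℝ) * n))
  exact ⟨U, hU, by linarith⟩

end LargeReconstructible

section Threshold

lemma tendsto_log_natCast_atTop : Tendsto (fun n : ℕ => Real.log n) atTop atTop :=
  Real.tendsto_log_atTop.comp tendsto_natCast_atTop_atTop

lemma natCast_mul_poissonAtMostOne {n : ℕ} (hn : 0 < Real.log n) (t : ℝ) :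
    n * poissonAtMostOne (Real.log n + Real.log (Real.log n) + t) =
      Real.exp (-t) * ((1 + Real.log n + Real.log (Real.log n) + t) / Real.log n) := by
  have hn0 : (0 : ℝ) < n := Nat.cast_pos.2 (Nat.pos_of_ne_zero (by rintro rfl; simp at hn))
  rw [poissonAtMostOne, neg_add, neg_add, Real.exp_add, Real.exp_add, Real.exp_neg,
    Real.exp_log hn0, Real.exp_neg, Real.exp_log hn]
  field_simp
  ring

lemma tendsto_natCast_mul_poissonAtMostOne {t : ℕ → ℝ} (ht : Tendsto t atTop atTop) :
    Tendsto (fun n : ℕ => n * poissonAtMostOne (Real.log n + Real.log (Real.log n) + t n))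
      atTop (𝓝 0) := by
  have hlim : Tendsto (fun n => Real.exp (-t n) * (3 + t n)) atTop (𝓝 0) := by
    have h0 := (Real.tendsto_pow_mul_exp_neg_atTop_nhds_zero 0).comp ht
    have h1 := (Real.tendsto_pow_mul_exp_neg_atTop_nhds_zero 1).comp ht
    simpa [Function.comp_def, add_mul, mul_comm (Real.exp _)] using (h0.const_mul 3).add h1
  refine squeeze_zero' ?_ ?_ hlim
  all_goals
    filter_upwards [tendsto_log_natCast_atTop.eventually_ge_atTop 1,
      ht.eventually_ge_atTop 0] with n hlog htn
    have hloglog := Real.log_nonneg hlog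
  · exact mul_nonneg n.cast_nonneg (poissonAtMostOne_nonneg (by linarith))
  · have hloglog' := Real.log_le_sub_one_of_pos (by linarith : 0 < Real.log n)
    rw [natCast_mul_poissonAtMostOne (by linarith)]
    gcongr
    rw [div_le_iff₀ (by linarith)]
    nlinarith

lemma whp_eq_univ_of_nearlyClosed {p : ℕ → I} {t : ℕ → ℝ} (ht : Tendsto t atTop atTop)
    (hp : ∀ᶠ n : ℕ in atTop,
      Real.log n + Real.log (Real.log n) + t n ≤ (p n : ℝ) * n - 3) :
    Whp p fun n G => ∀ R, NearlyClosed G R → (n : ℝ) - 2 / p n < #R → R = univ := by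
  have hlim := tendsto_natCast_mul_poissonAtMostOne ht
  refine .of_real_le (b := fun n : ℕ =>
    Real.exp (n * poissonAtMostOne (Real.log n + Real.log (Real.log n) + t n)) - 1)
    (by simpa using (hlim.rexp).sub_const 1) ?_
  filter_upwards [hp, tendsto_log_natCast_atTop.eventually_ge_atTop 1,
    ht.eventually_ge_atTop 0] with n hpn hlog htn
  have hloglog := Real.log_nonneg hlog
  have h := binomialRandom_real_exists_large_nearlyClosed_le (V := Fin n) (p := p n)
    (by rw [Fintype.card_fin]; linarith)
  rw [Fintype.card_fin] at h
  calc G(Fin n, p n).real {G | ¬ ∀ R, NearlyClosed G R → (n : ℝ) - 2 / p n < #R → R = univ}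
      = G(Fin n, p n).real {G | ∃ R, NearlyClosed G R ∧ R ≠ univ ∧ (n : ℝ) - 2 / p n < #R} := by
        push Not
        simp only [and_comm, ne_eq]
    _ ≤ Real.exp (n * poissonAtMostOne (p n * n - 3)) - 1 := h
    _ ≤ _ := by
        gcongr
        exact antitoneOn_poissonAtMostOne (Set.mem_Ici.2 (by linarith))
          (Set.mem_Ici.2 (by linarith)) hpn

theorem whp_reconstructible_univ (v : (n : ℕ) → Fin n → ℝ) (p : ℕ → I) (ω : ℕ → ℝ)
    (hv : ∀ n, Function.Injective (v n)) (hω : Tendsto ω atTop atTop)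
    (hp : ∀ᶠ n : ℕ in atTop,
      (Real.log n + Real.log (Real.log n) + ω n) / (n : ℝ) ≤ (p n : ℝ)) :
    Whp p fun n G => Reconstructible (v n) G univ := by
  have hp' := eventually_le_mul_of_eventually_div_le hp
  have h42 : ∀ᶠ n : ℕ in atTop, 42 ≤ (p n : ℝ) * n := by
    filter_upwards [hp', tendsto_log_natCast_atTop.eventually_ge_atTop 1,
      hω.eventually_ge_atTop 42] with n hpn hlog hωn
    linarith [Real.log_nonneg hlog]
  have hω3 : Tendsto (fun n => ω n - 3) atTop atTop := tendsto_atTop_add_const_right _ _ hω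
  have hlarge := whp_eq_univ_of_nearlyClosed (p := p) hω3 (hp'.mono fun n hn => by linarith)
  refine ((whp_exists_reconstructible h42 hv).and hlarge).mono (.of_forall fun n G => ?_)
  rintro ⟨⟨U, hU, hclosed, hcard⟩, huniv⟩
  exact huniv U hclosed hcard ▸ hU

end Threshold

section LooseVertices

/-- The vertex `u` has at most one neighbour in `D`, and such a neighbour lies in `T`. The set `T`
is meant to be a subset of `D`. -/
def IsLoose {V : Type*} (G : SimpleGraph V) (D T : Finset V) (u : V) : Prop :=
  ∃ o ∈ insertNone T, HasStar G D u o

lemma IsLoose.inter {V : Type*} [DecidableEq V] {G : SimpleGraph V} {D D' T : Finset V} {u : V}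
    (h : IsLoose G D T u) (hD : D' ⊆ D) : IsLoose G D' (T ∩ D') u := by
  obtain ⟨_ | x, hx, hstar⟩ := h
  · exact ⟨none, none_mem_insertNone, fun y hy => hstar y (hD hy)⟩
  · by_cases hxD : x ∈ D'
    · exact ⟨some x, some_mem_insertNone.2 (mem_inter.2 ⟨some_mem_insertNone.1 hx, hxD⟩),
        fun y hy => hstar y (hD hy)⟩
    · refine ⟨none, none_mem_insertNone, fun y hy => ?_⟩
      rw [hstar y (hD hy), Option.some_inj]
      exact iff_of_false (fun h => hxD (h ▸ hy)) nofun

variable {n : ℕ} {v : Fin n → ℝ}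

lemma not_reconstructible_univ_of_move (hv : Function.Injective v) {G : SimpleGraph (Fin n)}
    {u y : Fin n} (hyu : y ≠ u) {t : ℝ} (ht : ∀ i, v i ≠ t) (hty : t ≠ 2 * v y - v u)
    (hadj : ∀ x, G.Adj u x → |t - v x| = |v u - v x|) : ¬ Reconstructible v G univ := by
  intro h
  have hw : Function.Injective (Function.update v u t) := by
    intro i j hij
    by_cases hi : i = u <;> by_cases hj : j = u
    · exact hi.trans hj.symm
    · subst hi
      exact absurd (by simpa [hj] using hij.symm) (ht j)
    · subst hj
      exact absurd (by simpa [hi] using hij) (ht i)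
    · exact hv (by simpa [hi, hj] using hij)
  have hG (i j : Fin n) (hij : G.Adj i j) :
      |Function.update v u t i - Function.update v u t j| = |v i - v j| := by
    by_cases hi : i = u
    · subst hi
      simpa [hij.ne'] using hadj j hij
    · by_cases hj : j = u
      · subst hj
        simpa [hi, abs_sub_comm] using hadj i hij.symm
      · simp [hi, hj]
  have huy := h _ hw hG u (mem_univ _) y (mem_univ _)
  rw [Function.update_self, Function.update_of_ne hyu, abs_sub_eq_abs_sub_iff] at huy
  rcases huy with huy | huy
  · exact ht u (by linarith)
  · exact hty (by linarith)

/-- The points other than `u` in which `u` can be reflected without hitting another point. -/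
noncomputable def freeReflections (v : Fin n → ℝ) (u : Fin n) : Finset (Fin n) :=
  {x | x ≠ u ∧ ∀ i, v i ≠ 2 * v x - v u}

lemma freeReflections_subset_compl (v : Fin n → ℝ) (u : Fin n) : freeReflections v u ⊆ {u}ᶜ := by
  intro x hx
  rw [mem_compl, mem_singleton]
  exact ((mem_filter_univ _).1 hx).1

lemma not_reconstructible_univ_of_isLoose (hn : 3 ≤ n) (hv : Function.Injective v)
    {G : SimpleGraph (Fin n)} {u : Fin n} (hu : IsLoose G {u}ᶜ (freeReflections v u) u) :
    ¬ Reconstructible v G univ := by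
  have hcard (x : Fin n) : ∃ y, y ∉ ({u, x} : Finset (Fin n)) := by
    by_contra! h
    have hle := card_le_card fun y (_ : y ∈ univ) => h y
    rw [card_univ, Fintype.card_fin] at hle
    exact absurd (hle.trans card_le_two) (by omega)
  obtain ⟨_ | x, ho, hstar⟩ := hu
  · obtain ⟨y, hy⟩ := hcard u
    obtain ⟨t, ht⟩ := Infinite.exists_notMem_finset (insert (2 * v y - v u) (univ.image v))
    simp only [mem_insert, mem_image, mem_univ, true_and, not_or, not_exists] at ht
    refine not_reconstructible_univ_of_move hv (by simpa using hy) ht.2 ht.1 fun x hx => ?_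
    simpa using (hstar x (by simpa using hx.ne')).1 hx
  · obtain ⟨-, hfree⟩ := (mem_filter_univ _).1 (some_mem_insertNone.1 ho)
    obtain ⟨y, hy⟩ := hcard x
    simp only [mem_insert, mem_singleton, not_or] at hy
    refine not_reconstructible_univ_of_move hv hy.1 hfree
      (fun h => hy.2 (hv (by linarith))) fun z hz => ?_
    obtain rfl : x = z := Option.some_inj.1 ((hstar z (by simpa using hz.ne')).1 hz)
    rw [abs_sub_eq_abs_sub_iff]
    right
    ring

lemma le_card_filter_mem_freeReflections (hv : Function.Injective v) (x : Fin n) :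
    n - 1 - 2 * #{y | v y < v x} ≤ #{u | x ∈ freeReflections v u} := by
  let A : Finset (Fin n) := {u | x ∈ freeReflections v u}
  let L : Finset (Fin n) := {y | v y < v x}
  let B : Finset (Fin n) := {u | v x < v u ∧ ∃ i, v i = 2 * v x - v u}
  -- Reflection in `x` maps `B` into `L`.
  have hBL : #B ≤ #L := by
    have hex : ∀ u ∈ B, ∃ i ∈ L, v i = 2 * v x - v u := by
      intro u hu
      obtain ⟨hxu, i, hi⟩ := (mem_filter_univ _).1 hu
      exact ⟨i, (mem_filter_univ _).2 (by linarith), hi⟩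
    choose! g hgL hg using hex
    refine card_le_card_of_injOn g hgL fun a ha b hb hab => hv ?_
    have hga := hg a ha
    rw [hab, hg b hb] at hga
    linarith
  have hcover : univ ⊆ insert x (A ∪ (L ∪ B)) := by
    intro u _
    simp only [A, L, B, freeReflections, mem_insert, mem_union, mem_filter_univ]
    by_cases hux : u = x
    · exact .inl hux
    by_cases hi : ∃ i, v i = 2 * v x - v u
    · have hvux : v u ≠ v x := hv.ne hux
      grind
    · exact .inr (.inl ⟨Ne.symm hux, by simpa using hi⟩)
  have hcard := card_le_card hcover
  rw [card_univ, Fintype.card_fin] at hcard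
  have := card_insert_le x (A ∪ (L ∪ B))
  have := card_union_le A (L ∪ B)
  have := card_union_le L B
  change n - 1 - 2 * #L ≤ #A
  omega

lemma card_filter_lt_sort_le (v : Fin n → ℝ) (k : Fin n) :
    #{y | v y < v (Tuple.sort v k)} ≤ k := by
  calc #{y | v y < v (Tuple.sort v k)} ≤ #((Iio k).map (Tuple.sort v).toEmbedding) := by
        refine card_le_card fun y hy => ?_
        obtain ⟨j, rfl⟩ := (Tuple.sort v).surjective y
        have hlt : v (Tuple.sort v j) < v (Tuple.sort v k) := by simpa using hy
        exact mem_map_of_mem _ (mem_Iio.2 ((Tuple.monotone_sort v).reflect_lt hlt))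
    _ = k := by rw [card_map, Fin.card_Iio]

lemma sum_range_le_sum_card_freeReflections (hv : Function.Injective v) :
    ∑ k ∈ range n, (n - 1 - 2 * k) ≤ ∑ u, #(freeReflections v u) := by
  have hswap : ∑ u, #(freeReflections v u) = ∑ x, #{u | x ∈ freeReflections v u} := by
    simpa [bipartiteAbove, bipartiteBelow] using
      sum_card_bipartiteAbove_eq_sum_card_bipartiteBelow (s := univ) (t := univ)
        fun u x => x ∈ freeReflections v u
  rw [hswap, ← Equiv.sum_comp (Tuple.sort v), ← Fin.sum_univ_eq_sum_range fun k => n - 1 - 2 * k]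
  gcongr with k
  have := card_filter_lt_sort_le v k
  have := le_card_filter_mem_freeReflections hv (Tuple.sort v k)
  omega

lemma sq_div_sixteen_le_sum_range (hn : 16 ≤ n) :
    (n : ℝ) ^ 2 / 16 ≤ (∑ k ∈ range n, (n - 1 - 2 * k) : ℕ) := by
  have hsum : n / 4 * (n - 1 - 2 * (n / 4)) ≤ ∑ k ∈ range n, (n - 1 - 2 * k) :=
    calc n / 4 * (n - 1 - 2 * (n / 4)) = ∑ k ∈ range (n / 4), (n - 1 - 2 * (n / 4)) := by simp
      _ ≤ ∑ k ∈ range (n / 4), (n - 1 - 2 * k) := by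
          gcongr with k hk
          exact (mem_range.1 hk).le
      _ ≤ ∑ k ∈ range n, (n - 1 - 2 * k) :=
          sum_le_sum_of_subset (range_mono (Nat.div_le_self _ _))
  have hquarter : (n : ℝ) ≤ 4 * (n / 4 : ℕ) + 3 := by
    exact_mod_cast (by omega : n ≤ 4 * (n / 4) + 3)
  have hhalf : (n : ℝ) ≤ 2 * (n - 1 - 2 * (n / 4) : ℕ) + 2 := by
    exact_mod_cast (by omega : n ≤ 2 * (n - 1 - 2 * (n / 4)) + 2)
  have hn' : (16 : ℝ) ≤ n := by exact_mod_cast hn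
  calc (n : ℝ) ^ 2 / 16 ≤ (n - 3) / 4 * ((n - 2) / 2) := by nlinarith
    _ ≤ (n / 4 : ℕ) * (n - 1 - 2 * (n / 4) : ℕ) := by
        gcongr <;> linarith
    _ ≤ _ := by exact_mod_cast hsum

end LooseVertices

section SecondMoment

lemma variance_sum_indicator_le {Ω ι : Type*} [MeasurableSpace Ω] [Fintype ι] (μ : Measure Ω)
    [IsProbabilityMeasure μ] {B : ι → Set Ω} (hB : ∀ i, MeasurableSet (B i)) {δ : ℝ} (hδ : 0 ≤ δ)
    (hpair : ∀ i j, i ≠ j → μ.real (B i ∩ B j) ≤ (1 + δ) * (μ.real (B i) * μ.real (B j))) :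
    Var[∑ i, (B i).indicator 1; μ] ≤ (∑ i, μ.real (B i)) + δ * (∑ i, μ.real (B i)) ^ 2 := by
  classical
  have hmem (i : ι) : MemLp ((B i).indicator (1 : Ω → ℝ)) 2 μ :=
    memLp_indicator_const 2 (hB i) 1 (.inr (measure_ne_top μ _))
  have hcov (i j : ι) : cov[(B i).indicator 1, (B j).indicator 1; μ] =
      μ.real (B i ∩ B j) - μ.real (B i) * μ.real (B j) := by
    rw [covariance_eq_sub (hmem i) (hmem j), ← Set.inter_indicator_one,
      integral_indicator_one ((hB i).inter (hB j)), integral_indicator_one (hB i),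
      integral_indicator_one (hB j)]
  calc Var[∑ i, (B i).indicator 1; μ]
      = ∑ i, ∑ j, (μ.real (B i ∩ B j) - μ.real (B i) * μ.real (B j)) := by
        simp_rw [variance_sum hmem, hcov]
    _ ≤ ∑ i, ∑ j, ((if i = j then μ.real (B i) else 0) +
          δ * (μ.real (B i) * μ.real (B j))) := by
        gcongr with i _ j _
        split_ifs with hij
        · subst hij
          rw [Set.inter_self]
          nlinarith [sq_nonneg (μ.real (B i))]
        · linarith [hpair i j hij]
    _ = (∑ i, μ.real (B i)) + δ * (∑ i, μ.real (B i)) ^ 2 := by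
        simp only [sum_add_distrib, sum_ite_eq, mem_univ, if_true, ← mul_sum, ← sum_mul, sq]

lemma measureReal_forall_notMem_le {Ω ι : Type*} [MeasurableSpace Ω] [Fintype ι] (μ : Measure Ω)
    [IsProbabilityMeasure μ] {B : ι → Set Ω} (hB : ∀ i, MeasurableSet (B i)) {δ : ℝ} (hδ : 0 ≤ δ)
    (hpair : ∀ i j, i ≠ j → μ.real (B i ∩ B j) ≤ (1 + δ) * (μ.real (B i) * μ.real (B j)))
    (hpos : 0 < ∑ i, μ.real (B i)) :
    μ.real {x | ∀ i, x ∉ B i} ≤ (∑ i, μ.real (B i))⁻¹ + δ := by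
  set m := ∑ i, μ.real (B i)
  let X : Ω → ℝ := ∑ i, (B i).indicator 1
  have hmem (i : ι) : MemLp ((B i).indicator (1 : Ω → ℝ)) 2 μ :=
    memLp_indicator_const 2 (hB i) 1 (.inr (measure_ne_top μ _))
  have hmean : μ[X] = m := by
    simp only [X, Finset.sum_apply]
    rw [integral_finsetSum _ fun i _ => (hmem i).integrable one_le_two]
    exact sum_congr rfl fun i _ => integral_indicator_one (hB i)
  have hsub : {x | ∀ i, x ∉ B i} ⊆ {x | m ≤ |X x - μ[X]|} := by
    intro x hx
    have hX : X x = 0 := by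
      simp only [X, Finset.sum_apply]
      exact sum_eq_zero fun i _ => Set.indicator_of_notMem (hx i) _
    simp [hX, hmean, abs_of_pos hpos]
  calc μ.real {x | ∀ i, x ∉ B i} ≤ Var[X; μ] / m ^ 2 := by
        refine (measureReal_mono hsub).trans (ENNReal.toReal_le_of_le_ofReal ?_ ?_)
        · exact div_nonneg (variance_nonneg X μ) (sq_nonneg m)
        · exact meas_ge_le_variance_div_sq (memLp_finsetSum' _ fun i _ => hmem i) hpos
    _ ≤ (m + δ * m ^ 2) / m ^ 2 := by
        gcongr
        exact variance_sum_indicator_le μ hB hδ hpair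
    _ = m⁻¹ + δ := by field_simp

variable {V : Type*}

/-- The probability that a vertex is loose with respect to sets `D` and `T ⊆ D` of `d` and `t`
vertices. -/
noncomputable def looseProb (p : ℝ) (d t : ℕ) : ℝ :=
  (1 - p) ^ d + t * (p * (1 - p) ^ (d - 1))

lemma one_sub_mul_looseProb_le {p : ℝ} (hp0 : 0 ≤ p) (hp1 : p ≤ 1) {d s t : ℕ} (hd : 0 < d)
    (hst : s ≤ t) : (1 - p) * looseProb p d s ≤ looseProb p (d + 1) t := by
  obtain ⟨k, rfl⟩ := Nat.exists_eq_add_of_lt hd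
  have : 0 ≤ 1 - p := sub_nonneg.2 hp1
  have hst' : (s : ℝ) ≤ t := by exact_mod_cast hst
  calc (1 - p) * looseProb p (0 + k + 1) s = looseProb p (0 + k + 1 + 1) s := by
        simp only [looseProb, Nat.add_sub_cancel]
        ring
    _ ≤ looseProb p (0 + k + 1 + 1) t := by
        unfold looseProb
        gcongr

lemma binomialRandom_real_isLoose [Finite V] (p : I) {D T : Finset V} {u : V} (hu : u ∉ D)
    (hT : T ⊆ D) : G(V, p).real {G | IsLoose G D T u} = looseProb p #D #T := by
  have hset : {G | IsLoose G D T u} = ⋃ o ∈ insertNone T, {G | HasStar G D u o} := by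
    ext G
    simp only [IsLoose, Set.mem_ofPred_eq, Set.mem_iUnion, exists_prop]
  have hdisj : (↑(insertNone T) : Set (Option V)).PairwiseDisjoint
      fun o => {G | HasStar G D u o} := by
    intro o ho o' ho' hne
    refine Set.disjoint_left.2 fun G hG hG' => hne (Option.ext fun x => ?_)
    constructor <;> rintro rfl
    · exact (hG' x (hT (some_mem_insertNone.1 ho))).1 ((hG x (hT (some_mem_insertNone.1 ho))).2 rfl)
    · exact (hG x (hT (some_mem_insertNone.1 ho'))).1
        ((hG' x (hT (some_mem_insertNone.1 ho'))).2 rfl)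
  rw [hset, measureReal_biUnion_finset hdisj fun _ _ => .of_discrete]
  simp_rw [binomialRandom_real_hasStar p hu]
  exact sum_insertNone_starWeight _ hT

lemma binomialRandom_real_isLoose_and_isLoose_le [Finite V] (p : I) {D T T' : Finset V} {u u' : V}
    (huu' : u ≠ u') (hu : u ∉ D) (hu' : u' ∉ D) (hT : T ⊆ D) (hT' : T' ⊆ D) :
    G(V, p).real {G | IsLoose G D T u ∧ IsLoose G D T' u'} ≤
      looseProb p #D #T * looseProb p #D #T' := by
  calc G(V, p).real {G | IsLoose G D T u ∧ IsLoose G D T' u'}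
      ≤ ∑ x ∈ insertNone T ×ˢ insertNone T',
          G(V, p).real {G | HasStar G D u x.1 ∧ HasStar G D u' x.2} := by
        refine (measureReal_mono ?_).trans (measureReal_exists_mem_le _ _ _)
        rintro G ⟨⟨o, ho, hstar⟩, o', ho', hstar'⟩
        exact ⟨(o, o'), mem_product.2 ⟨ho, ho'⟩, hstar, hstar'⟩
    _ = ∑ x ∈ insertNone T ×ˢ insertNone T', starWeight p D x.1 * starWeight p D x.2 :=
        sum_congr rfl fun x _ =>
          binomialRandom_real_hasStar_and_hasStar p huu' hu hu' (fun h => absurd h hu) x.1 x.2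
    _ = looseProb p #D #T * looseProb p #D #T' := by
        rw [sum_product, ← sum_mul_sum, sum_insertNone_starWeight _ hT,
          sum_insertNone_starWeight _ hT', looseProb, looseProb]

variable [Fintype V] [DecidableEq V]

lemma binomialRandom_real_isLoose_compl_and_le {p : I} (hp : (p : ℝ) < 1)
    (hV : 3 ≤ Fintype.card V) {u u' : V} (huu' : u ≠ u') (T T' : Finset V) :
    G(V, p).real {G | IsLoose G {u}ᶜ T u ∧ IsLoose G {u'}ᶜ T' u'} ≤ ((1 - p : ℝ) ^ 2)⁻¹ *
      (looseProb p (Fintype.card V - 1) #T * looseProb p (Fintype.card V - 1) #T') := by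
  let D : Finset V := {u, u'}ᶜ
  have hq : 0 < 1 - (p : ℝ) := sub_pos.2 hp
  have hcard : #D + 1 = Fintype.card V - 1 := by
    rw [card_compl, card_pair huu']
    omega
  have hle (S : Finset V) : looseProb p #D #(S ∩ D) ≤
      (1 - p : ℝ)⁻¹ * looseProb p (Fintype.card V - 1) #S := by
    rw [le_inv_mul_iff₀ hq, ← hcard]
    exact one_sub_mul_looseProb_le p.2.1 p.2.2 (by omega) (card_le_card inter_subset_left)
  have hnonneg (d s : ℕ) : 0 ≤ looseProb p d s := by
    have := p.2.1
    unfold looseProb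
    positivity
  calc _ ≤ G(V, p).real {G | IsLoose G D (T ∩ D) u ∧ IsLoose G D (T' ∩ D) u'} :=
        measureReal_mono fun G hG => ⟨hG.1.inter (compl_subset_compl.2 (by simp)),
          hG.2.inter (compl_subset_compl.2 (by simp))⟩
    _ ≤ looseProb p #D #(T ∩ D) * looseProb p #D #(T' ∩ D) :=
        binomialRandom_real_isLoose_and_isLoose_le p huu' (by simp [D]) (by simp [D])
          inter_subset_right inter_subset_right
    _ ≤ (1 - p : ℝ)⁻¹ * looseProb p (Fintype.card V - 1) #T *
          ((1 - p : ℝ)⁻¹ * looseProb p (Fintype.card V - 1) #T') :=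
        mul_le_mul (hle T) (hle T') (hnonneg _ _) (mul_nonneg (inv_nonneg.2 hq.le) (hnonneg _ _))
    _ = _ := by
        rw [← inv_pow]
        ring

lemma binomialRandom_real_forall_not_isLoose_le {p : I} (hp : (p : ℝ) < 1)
    (hV : 3 ≤ Fintype.card V) {T : V → Finset V} (hT : ∀ u, T u ⊆ {u}ᶜ) :
    G(V, p).real {G | ∀ u, ¬ IsLoose G {u}ᶜ (T u) u} ≤
      (∑ u, looseProb p (Fintype.card V - 1) #(T u))⁻¹ + (((1 - p : ℝ) ^ 2)⁻¹ - 1) := by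
  have hp0 := p.2.1
  have hq : 0 < 1 - (p : ℝ) := sub_pos.2 hp
  have hprob (u : V) : G(V, p).real {G | IsLoose G {u}ᶜ (T u) u} =
      looseProb p (Fintype.card V - 1) #(T u) := by
    rw [binomialRandom_real_isLoose p (by simp) (hT u), card_compl, card_singleton]
  have hpos (u : V) : 0 < looseProb p (Fintype.card V - 1) #(T u) := by
    unfold looseProb
    positivity
  have hδ : 0 ≤ ((1 - p : ℝ) ^ 2)⁻¹ - 1 :=
    sub_nonneg.2 (one_le_inv_iff₀.2 ⟨by positivity, by nlinarith⟩)
  have : Nonempty V := Fintype.card_pos_iff.1 (by omega)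
  have h := measureReal_forall_notMem_le G(V, p) (B := fun u => {G | IsLoose G {u}ᶜ (T u) u})
    (fun u => .of_discrete) hδ (fun u u' huu' => ?_) ?_
  · simpa only [hprob, Set.mem_ofPred_eq] using h
  · simp only [hprob, add_sub_cancel]
    exact binomialRandom_real_isLoose_compl_and_le hp hV huu' (T u) (T u')
  · simp only [hprob]
    exact sum_pos (fun u _ => hpos u) univ_nonempty

end SecondMoment

section NotReconstructible

lemma exp_neg_mul_sub_one_le_one_sub_pow {p : ℝ} {n : ℕ} (hp : p ≤ 1 / 2)
    (hpn : p ^ 2 * n ≤ 1 / 2) : Real.exp (-(p * n) - 1) ≤ (1 - p) ^ n := by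
  have hq : 0 < 1 - p := by linarith
  have hlog : -p - 2 * p ^ 2 ≤ Real.log (1 - p) := by
    refine le_trans ?_ (Real.one_sub_inv_le_log_of_pos hq)
    have hinv : 1 - (1 - p)⁻¹ = -p / (1 - p) := by
      field_simp
      ring
    rw [hinv, le_div_iff₀ hq]
    nlinarith [mul_nonneg (sq_nonneg p) (by linarith : 0 ≤ 1 - 2 * p)]
  rw [← Real.exp_log hq, ← Real.exp_nat_mul, Real.exp_le_exp]
  nlinarith [mul_le_mul_of_nonneg_left hlog n.cast_nonneg]

lemma natCast_mul_poissonAtMostOne_le_sum_looseProb {n : ℕ} (hn : 16 ≤ n) {v : Fin n → ℝ}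
    (hv : Function.Injective v) {p : ℝ} (hp0 : 0 ≤ p) (hp : p ≤ 1 / 2) (hpn : p ^ 2 * n ≤ 1 / 2) :
    (16 * Real.exp 1)⁻¹ * (n * poissonAtMostOne (p * n)) ≤
      ∑ u, looseProb p (n - 1) #(freeReflections v u) := by
  have hq : 0 < 1 - p := by linarith
  have hpow {k : ℕ} (hk : k ≤ n) : (1 - p) ^ n ≤ (1 - p) ^ k :=
    pow_le_pow_of_le_one hq.le (by linarith) hk
  have hfree : (n : ℝ) ^ 2 / 16 ≤ ∑ u, (#(freeReflections v u) : ℝ) :=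
    (sq_div_sixteen_le_sum_range hn).trans
      (by exact_mod_cast sum_range_le_sum_card_freeReflections hv)
  calc (16 * Real.exp 1)⁻¹ * (n * poissonAtMostOne (p * n))
      = n / 16 * (Real.exp (-(p * n) - 1) * (1 + p * n)) := by
        rw [poissonAtMostOne, Real.exp_sub]
        field_simp
    _ ≤ n / 16 * ((1 - p) ^ n * (1 + p * n)) := by
        gcongr
        exact exp_neg_mul_sub_one_le_one_sub_pow hp hpn
    _ = n / 16 * (1 - p) ^ n + n ^ 2 / 16 * (p * (1 - p) ^ n) := by ring
    _ ≤ n * (1 - p) ^ (n - 1) +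
          (∑ u, (#(freeReflections v u) : ℝ)) * (p * (1 - p) ^ (n - 1 - 1)) := by
        gcongr ?_ * ?_ + ?_ * (p * ?_)
        · linarith [n.cast_nonneg (α := ℝ)]
        · exact hpow (Nat.sub_le n 1)
        · exact hpow (by omega)
    _ = ∑ u, looseProb p (n - 1) #(freeReflections v u) := by
        simp [looseProb, sum_add_distrib, sum_mul]

lemma tendsto_natCast_mul_poissonAtMostOne_atTop {y ω : ℕ → ℝ} (hω : Tendsto ω atTop atTop)
    (hy0 : ∀ n, 0 ≤ y n)
    (hy : ∀ᶠ n : ℕ in atTop, y n ≤ Real.log n + Real.log (Real.log n) - ω n) :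
    Tendsto (fun n : ℕ => n * poissonAtMostOne (y n)) atTop atTop := by
  -- Capping `ω` keeps the argument of `poissonAtMostOne` comparable to `log n`.
  have hmin : Tendsto (fun n : ℕ => min (ω n) (Real.log n / 2)) atTop atTop :=
    tendsto_atTop.2 fun b => (hω.eventually_ge_atTop b).mp <|
      ((tendsto_log_natCast_atTop.atTop_div_const two_pos).eventually_ge_atTop b).mono
        fun _ hlog hωn => le_min hωn hlog
  refine tendsto_atTop_mono' _ ?_
    ((Real.tendsto_exp_atTop.comp hmin).atTop_mul_const (by norm_num : (0 : ℝ) < 1 / 2))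
  filter_upwards [hy, tendsto_log_natCast_atTop.eventually_ge_atTop 1] with n hyn hlog
  have hloglog := Real.log_nonneg hlog
  set s := min (ω n) (Real.log n / 2)
  have hsω : s ≤ ω n := min_le_left _ _
  have hslog : s ≤ Real.log n / 2 := min_le_right _ _
  calc Real.exp s * (1 / 2)
      ≤ Real.exp (- -s) * ((1 + Real.log n + Real.log (Real.log n) + -s) / Real.log n) := by
        rw [neg_neg]
        refine mul_le_mul_of_nonneg_left ?_ (Real.exp_pos s).le
        rw [le_div_iff₀ (by linarith)]
        linarith
    _ = n * poissonAtMostOne (Real.log n + Real.log (Real.log n) + -s) :=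
        (natCast_mul_poissonAtMostOne (by linarith) (-s)).symm
    _ ≤ n * poissonAtMostOne (y n) := by
        gcongr
        exact antitoneOn_poissonAtMostOne (hy0 n) (Set.mem_Ici.2 (by linarith)) (by linarith)

lemma tendsto_sq_mul_natCast {p : ℕ → ℝ} (hp0 : ∀ n, 0 ≤ p n)
    (hp : ∀ᶠ n : ℕ in atTop, p n * n ≤ 2 * Real.log n) :
    Tendsto (fun n : ℕ => p n ^ 2 * n) atTop (𝓝 0) := by
  have hlim : Tendsto (fun n : ℕ => 4 * (Real.log n ^ 2 / n)) atTop (𝓝 0) := by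
    simpa using ((Real.isLittleO_pow_log_id_atTop (n := 2)).tendsto_div_nhds_zero.comp
      tendsto_natCast_atTop_atTop).const_mul 4
  refine squeeze_zero' (.of_forall fun n => by positivity) ?_ hlim
  filter_upwards [hp, eventually_gt_atTop 0] with n hpn hn
  have hn0 : (0 : ℝ) < n := Nat.cast_pos.2 hn
  calc p n ^ 2 * n = (p n * n) ^ 2 / n := by field_simp
    _ ≤ (2 * Real.log n) ^ 2 / n := by
        gcongr
        exact mul_nonneg (hp0 n) hn0.le
    _ = 4 * (Real.log n ^ 2 / n) := by ring

lemma tendsto_zero_of_tendsto_sq_mul_natCast {p : ℕ → ℝ} (hp0 : ∀ n, 0 ≤ p n)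
    (hp : Tendsto (fun n : ℕ => p n ^ 2 * n) atTop (𝓝 0)) : Tendsto p atTop (𝓝 0) := by
  have hsq : Tendsto (fun n => p n ^ 2) atTop (𝓝 0) := by
    refine squeeze_zero' (.of_forall fun n => sq_nonneg _) ?_ hp
    filter_upwards [eventually_ge_atTop 1] with n hn
    exact le_mul_of_one_le_right (sq_nonneg _) (by exact_mod_cast hn)
  simpa [Real.sqrt_sq (hp0 _)] using hsq.sqrt

theorem whp_not_reconstructible_univ (v : (n : ℕ) → Fin n → ℝ) (p : ℕ → I) (ω : ℕ → ℝ)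
    (hv : ∀ n, Function.Injective (v n)) (hω : Tendsto ω atTop atTop)
    (hp : ∀ᶠ n : ℕ in atTop,
      (p n : ℝ) ≤ (Real.log n + Real.log (Real.log n) - ω n) / (n : ℝ)) :
    Whp p fun n G => ¬ Reconstructible (v n) G univ := by
  have hp0 (n : ℕ) : 0 ≤ (p n : ℝ) := (p n).2.1
  have hp' : ∀ᶠ n : ℕ in atTop, (p n : ℝ) * n ≤ Real.log n + Real.log (Real.log n) - ω n := by
    filter_upwards [hp, eventually_gt_atTop 0] with n hpn hn
    rwa [le_div_iff₀ (Nat.cast_pos.2 hn)] at hpn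
  have hsq : Tendsto (fun n : ℕ => (p n : ℝ) ^ 2 * n) atTop (𝓝 0) := by
    refine tendsto_sq_mul_natCast hp0 ?_
    filter_upwards [hp', hω.eventually_ge_atTop 0,
      tendsto_log_natCast_atTop.eventually_gt_atTop 0] with n hpn hωn hlog
    linarith [Real.log_le_sub_one_of_pos hlog]
  have hpz := tendsto_zero_of_tendsto_sq_mul_natCast hp0 hsq
  have hδ : Tendsto (fun n => ((1 - p n : ℝ) ^ 2)⁻¹ - 1) atTop (𝓝 0) := by
    simpa using (((hpz.const_sub 1).pow 2).inv₀ (by norm_num)).sub_const 1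
  have hpoisson := (tendsto_natCast_mul_poissonAtMostOne_atTop hω
    (fun n => mul_nonneg (hp0 n) n.cast_nonneg) hp').const_mul_atTop
      (by positivity : 0 < (16 * Real.exp 1)⁻¹)
  have hlim := hpoisson.inv_tendsto_atTop.add hδ
  rw [add_zero] at hlim
  refine .of_real_le hlim ?_
  filter_upwards [hpoisson.eventually_gt_atTop 0, eventually_ge_atTop 16,
    hpz.eventually_le_const one_half_pos, hsq.eventually_le_const one_half_pos]
    with n hpos hn hhalf hsqn
  have hsum := natCast_mul_poissonAtMostOne_le_sum_looseProb hn (hv n) (hp0 n) hhalf hsqn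
  have h := binomialRandom_real_forall_not_isLoose_le (p := p n) (by linarith)
    (by rw [Fintype.card_fin]; omega) (freeReflections_subset_compl (v n))
  rw [Fintype.card_fin] at h
  calc G(Fin n, p n).real {G | ¬ ¬ Reconstructible (v n) G univ}
      ≤ G(Fin n, p n).real {G | ∀ u, ¬ IsLoose G {u}ᶜ (freeReflections (v n) u) u} :=
        measureReal_mono fun G hG u hu =>
          hG (not_reconstructible_univ_of_isLoose (by omega) (hv n) hu)
    _ ≤ _ := h.trans (add_le_add_left (inv_anti₀ hpos hsum) _)

end NotReconstructible

theorem theorem1p2 :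
    (∃ c : ℝ, 0 < c ∧
      ∀ (v : (n : ℕ) → Fin n → ℝ) (p : ℕ → I), (∀ n, Function.Injective (v n)) →
        (∀ᶠ n : ℕ in atTop, 42 / (n : ℝ) ≤ (p n : ℝ)) →
        Whp p fun n G => ∃ U : Finset (Fin n), Reconstructible (v n) G U ∧
          c * (n : ℝ) ≤ (U.card : ℝ)) ∧
    (∀ p : ℕ → I, Tendsto (fun n : ℕ => (p n : ℝ) * (n : ℝ)) atTop atTop →
      ∃ ε : ℕ → ℝ, Tendsto ε atTop (𝓝 0) ∧
        ∀ v : (n : ℕ) → Fin n → ℝ, (∀ n, Function.Injective (v n)) →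
          Whp p fun n G => ∃ U : Finset (Fin n), Reconstructible (v n) G U ∧
            (1 - ε n) * (n : ℝ) ≤ (U.card : ℝ)) ∧
    (∀ (v : (n : ℕ) → Fin n → ℝ) (p : ℕ → I) (ω : ℕ → ℝ), (∀ n, Function.Injective (v n)) →
      Tendsto ω atTop atTop →
      (∀ᶠ n : ℕ in atTop,
        (p n : ℝ) ≤ (Real.log n + Real.log (Real.log n) - ω n) / (n : ℝ)) →
      Whp p fun n G => ¬ Reconstructible (v n) G Finset.univ) ∧
    (∀ (v : (n : ℕ) → Fin n → ℝ) (p : ℕ → I) (ω : ℕ → ℝ), (∀ n, Function.Injective (v n)) →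
      Tendsto ω atTop atTop →
      (∀ᶠ n : ℕ in atTop,
        (Real.log n + Real.log (Real.log n) + ω n) / (n : ℝ) ≤ (p n : ℝ)) →
      Whp p fun n G => Reconstructible (v n) G Finset.univ) :=
  ⟨exists_linear_reconstructible, exists_almost_spanning_reconstructible,
    whp_not_reconstructible_univ, whp_reconstructible_univ⟩
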